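/- Let $\Bbbk$ be an arbitrary field. A Novikov dialgebra over $\Bbbk$ is a $\Bbbk$-linear space $N$ with two bilinear operations $\vdash,\dashv$ such that for all $x,y,z\in N$ $$(x\dashv y)\vdash z=(x\vdash y)\vdash z,\qquad x\dashv(y\vdash z)=x\dashv(y\dashv z),$$ $$(x\dashv y)\dashv z-x\dashv(y\dashv z)=(y\vdash x)\dashv z-y\vdash(x\dashv z),$$ $$(x\vdash y)\vdash z-x\vdash(y\vdash z)=(y\vdash x)\vdash z-y\vdash(x\vdash z),$$ $$(x\dashv y)\dashv z=(x\dashv z)\dashv y,\qquad (x\vdash y)\dashv z=(x\vdash z)\vdash y.$$ A differential Perm-algebra over $\Bbbk$ is an associative (not necessarily unital) $\Bbbk$-algebra $P$ satisfying $abc=bac$ for all $a,b,c\in P$, together with a $\Bbbk$-linear derivation $d:P\to P$, that is, $d(ab)=d(a)b+a\,d(b)$. Theorem. Every Novikov dialgebra $(N,\vdash,\dashv)$ over $\Bbbk$ embeds into a differential Perm-algebra over $\Bbbk$: there exist a differential Perm-algebra $(P,d)$ and an injective $\Bbbk$-linear map $\iota:N\to P$ such that for all $x,y\in N$ $$\iota(x\vdash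 y)=\iota(x)\,d(\iota(y)),\qquad \iota(x\dashv y)=d(\iota(y))\,\iota(x).$$ -/

import Mathlib

universe u v

/-- A linear space `N` over `k` with bilinear operations `vd` (written `x ⊢ y`) and
`dv` (written `x ⊣ y`) is a Novikov dialgebra: the 0-identities, the two dialgebra forms of
left-symmetry, and the two dialgebra forms of right-commutativity. -/
structure IsNovikovDialgebra {k N : Type*} [Field k] [AddCommGroup N] [Module k N]
    (vd dv : N →ₗ[k] N →ₗ[k] N) : Prop where
  /-- `(x ⊣ y) ⊢ z = (x ⊢ y) ⊢ z` -/
  zero_left : ∀ x y z : N, vd (dv x y) z = vd (vd x y) z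
  /-- `x ⊣ (y ⊢ z) = x ⊣ (y ⊣ z)` -/
  zero_right : ∀ x y z : N, dv x (vd y z) = dv x (dv y z)
  /-- `(x ⊣ y) ⊣ z - x ⊣ (y ⊣ z) = (y ⊢ x) ⊣ z - y ⊢ (x ⊣ z)` -/
  leftSymm_dv : ∀ x y z : N,
    dv (dv x y) z - dv x (dv y z) = dv (vd y x) z - vd y (dv x z)
  /-- `(x ⊢ y) ⊢ z - x ⊢ (y ⊢ z) = (y ⊢ x) ⊢ z - y ⊢ (x ⊢ z)` -/
  leftSymm_vd : ∀ x y z : N,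
    vd (vd x y) z - vd x (vd y z) = vd (vd y x) z - vd y (vd x z)
  /-- `(x ⊣ y) ⊣ z = (x ⊣ z) ⊣ y` -/
  rightComm_dv : ∀ x y z : N, dv (dv x y) z = dv (dv x z) y
  /-- `(x ⊢ y) ⊣ z = (x ⊢ z) ⊢ y` -/
  rightComm_vd : ∀ x y z : N, dv (vd x y) z = vd (vd x z) y

/-- A differential Perm-algebra over `k`: an associative (not necessarily unital) `k`-algebra `P`
satisfying `x y z = y x z`, with a `k`-linear derivation `d`. -/
structure IsDifferentialPermAlgebra {k P : Type*} [Field k] [NonUnitalRing P] [Module k P]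
    [IsScalarTower k P P] [SMulCommClass k P P] (d : P →ₗ[k] P) : Prop where
  left_comm : ∀ x y z : P, x * y * z = y * x * z
  leibniz : ∀ x y : P, d (x * y) = d x * y + x * d y

/-! Let `N̄` be the quotient of `N` by the differences `x ⊣ y - x ⊢ y`. It acts on `N` from the left
by `⊢` and from the right by `⊣`, and the dialgebra identities make `N̄ × N`, with zero product on
`N`, a Novikov algebra. If `j` embeds it into a differential commutative algebra `A`, then `x ↦ (j
(x̄, 0), j (0, x))` embeds `N` into `A × A` with product `(a, b)(c, e) = (ac, ae)`: there `ι x * d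
(ι y)` sees the left action and `d (ι y) * ι x` the right one.

It remains to embed a Novikov algebra `M` so that `x ∘ y = x y'`; the argument never divides, so the
characteristic plays no role. The element `y'` should act as right multiplication `r y`, and `y d`
should act on `M` as left multiplication. Let `C` be the commutative algebra generated by the right
multiplications and `S = Sym_C M`. Each `y` gives a derivation `D y` of `S` in the role of `y d`,
and the rule `x⁽ⁿ⁺²⁾ y = [y d, x⁽ⁿ⁺¹⁾]` defines operators `τ n x` recursively. They lower degree by
`n` and are `S`-linear in degrees at least `n`, which forces them to commute
(`IsDerivativeTower.commute`).

They need not commute with multiplication by `M`. The free differential algebra is therefore mapped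
to `End S` by a linear map `Θ` that applies multiplications first. `Θ` kills the differential ideal
generated by `x ∘ y - x y'`, while `Θ x` sends `1` to `x`; hence `M` survives in the quotient. -/

/-! ### Maps and derivations out of symmetric algebras -/

open scoped IsMulCommutative in
/-- The universal property of the symmetric algebra for linear maps with commuting values in a
possibly noncommutative algebra. -/
theorem SymmetricAlgebra.exists_lift_of_commute {R M B : Type*} [CommRing R] [AddCommGroup M]
    [Module R M] [Ring B] [Algebra R B] (f : M →ₗ[R] B) (hf : ∀ x y, f x * f y = f y * f x) :
    ∃ g : SymmetricAlgebra R M →ₐ[R] B, ∀ x, g (SymmetricAlgebra.ι R M x) = f x := by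
  have hcomm : ∀ a ∈ Set.range f, ∀ b ∈ Set.range f, a * b = b * a := by
    rintro _ ⟨x, rfl⟩ _ ⟨y, rfl⟩
    exact hf x y
  have := Algebra.isMulCommutative_adjoin R hcomm
  let f' : M →ₗ[R] Algebra.adjoin R (Set.range f) :=
    { toFun := fun x => ⟨f x, Algebra.subset_adjoin ⟨x, rfl⟩⟩
      map_add' := fun x y => Subtype.ext (f.map_add x y)
      map_smul' := fun c x => Subtype.ext (f.map_smul c x) }
  let g : SymmetricAlgebra R M →ₐ[R] Algebra.adjoin R (Set.range f) :=
    SymmetricAlgebra.lift f'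
  refine ⟨(Algebra.adjoin R (Set.range f)).val.comp g, fun x => ?_⟩
  rw [AlgHom.comp_apply, SymmetricAlgebra.lift_ι_apply f']
  rfl

/-- The semilinear form of the universal property is needed because a derivation that moves the
coefficients is not `C`-linear. -/
theorem SymmetricAlgebra.exists_ringHom {C M B : Type*} [CommRing C] [AddCommGroup M]
    [Module C M] [CommRing B] (φ : C →+* B) (f : M →+ B) (hf : ∀ c m, f (c • m) = φ c * f m) :
    ∃ g : SymmetricAlgebra C M →+* B, (∀ c, g (algebraMap C _ c) = φ c) ∧
      ∀ m, g (SymmetricAlgebra.ι C M m) = f m := by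
  let _ := φ.toAlgebra
  let f' : M →ₗ[C] B := { f with map_smul' := fun c m => by
                                  rw [Algebra.smul_def]; exact hf c m }
  exact ⟨(SymmetricAlgebra.lift f').toRingHom, (SymmetricAlgebra.lift f').commutes,
    SymmetricAlgebra.lift_ι_apply f'⟩

theorem SymmetricAlgebra.ringHom_ext_of {C M B : Type*} [CommRing C] [AddCommGroup M]
    [Module C M] [CommRing B] {g h : SymmetricAlgebra C M →+* B}
    (h₁ : ∀ c, g (algebraMap C _ c) = h (algebraMap C _ c))
    (h₂ : ∀ m, g (SymmetricAlgebra.ι C M m) = h (SymmetricAlgebra.ι C M m)) : g = h := by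
  refine RingHom.ext fun s => ?_
  induction s using SymmetricAlgebra.induction with
  | algebraMap r => exact h₁ r
  | ι x => exact h₂ x
  | mul a b ha hb => rw [map_mul, map_mul, ha, hb]
  | add a b ha hb => rw [map_add, map_add, ha, hb]

/-- A derivation of the coefficient ring and a compatible map on the module extend to a
derivation of the symmetric algebra. -/
theorem SymmetricAlgebra.exists_derivation {k C M : Type*} [CommRing k] [CommRing C] [Algebra k C]
    [AddCommGroup M] [Module k M] [Module C M] [IsScalarTower k C M]
    (δ : Derivation k C C) (l : M →ₗ[k] SymmetricAlgebra C M)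
    (hl : ∀ (c : C) (m : M), l (c • m) = δ c • SymmetricAlgebra.ι C M m + c • l m) :
    ∃ D : Derivation k (SymmetricAlgebra C M) (SymmetricAlgebra C M),
      (∀ c, D (algebraMap C _ c) = algebraMap C _ (δ c)) ∧
      ∀ m, D (SymmetricAlgebra.ι C M m) = l m := by
  let S := SymmetricAlgebra C M
  -- A derivation `D` is the same as a ring map `s ↦ s + ε D s` to the dual numbers over `S`; `φ`
  -- and `f` prescribe it on coefficients and generators.
  let φ : C →+* TrivSqZeroExt S S :=
    { toFun := fun c => (algebraMap C S c, algebraMap C S (δ c))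
      map_one' := by
        apply TrivSqZeroExt.ext
        · exact map_one _
        · change algebraMap C S (δ 1) = 0
          simp
      map_zero' := by
        apply TrivSqZeroExt.ext
        · exact map_zero _
        · change algebraMap C S (δ 0) = 0
          simp
      map_mul' := fun a b => by
        apply TrivSqZeroExt.ext
        · exact map_mul _ _ _
        · change algebraMap C S (δ (a * b)) = algebraMap C S a * algebraMap C S (δ b) +
            algebraMap C S (δ a) * algebraMap C S b
          simp [mul_comm]
      map_add' := fun a b => by
        apply TrivSqZeroExt.ext
        · exact map_add _ _ _
        · change algebraMap C S (δ (a + b)) = algebraMap C S (δ a) + algebraMap C S (δ b)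
          simp }
  let f : M →+ TrivSqZeroExt S S :=
    { toFun := fun m => (SymmetricAlgebra.ι C M m, l m)
      map_zero' := by
        apply TrivSqZeroExt.ext
        · exact map_zero _
        · exact map_zero _
      map_add' := fun a b => by
        apply TrivSqZeroExt.ext
        · exact map_add _ _ _
        · exact map_add _ _ _ }
  obtain ⟨g, hg₁, hg₂⟩ := SymmetricAlgebra.exists_ringHom φ f (fun c m => by
    apply TrivSqZeroExt.ext
    · change SymmetricAlgebra.ι C M (c • m) = algebraMap C S c * SymmetricAlgebra.ι C M m
      rw [map_smul, Algebra.smul_def]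
    · change l (c • m) = algebraMap C S c * l m +
        algebraMap C S (δ c) * SymmetricAlgebra.ι C M m
      rw [hl, Algebra.smul_def, Algebra.smul_def]
      ring)
  have hfst : ∀ s, (g s).fst = s := by
    have : (TrivSqZeroExt.fstHom S S S).toRingHom.comp g = RingHom.id S := by
      refine SymmetricAlgebra.ringHom_ext_of (fun c => ?_) (fun m => ?_)
      · change (g (algebraMap C S c)).fst = _
        rw [hg₁]; rfl
      · change (g (SymmetricAlgebra.ι C M m)).fst = _
        rw [hg₂]; rfl
    exact fun s => congrArg (fun h : S →+* S => h s) this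
  have hmul : ∀ a b, (g (a * b)).snd = a * (g b).snd + b * (g a).snd := fun a b => by
    rw [map_mul, TrivSqZeroExt.snd_mul, hfst, hfst, op_smul_eq_smul]
    rfl
  have hc : ∀ c, (g (algebraMap C S c)).snd = algebraMap C S (δ c) := fun c => by
    rw [hg₁]; rfl
  refine ⟨Derivation.mk' (R := k) (A := S) (M := S)
    { toFun := fun s => (g s).snd
      map_add' := fun a b => by rw [map_add]; rfl
      map_smul' := fun t s => ?_ } hmul, hc, fun m => ?_⟩
  · have : t • s = algebraMap C S (algebraMap k C t) * s := by
      rw [← Algebra.smul_def, algebraMap_smul]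
    rw [this, hmul, hc, Derivation.map_algebraMap, map_zero, mul_zero, add_zero,
      ← Algebra.smul_def, algebraMap_smul]
    rfl
  · change (g (SymmetricAlgebra.ι C M m)).snd = _
    rw [hg₂]; rfl

/-! ### Operators representing higher derivatives -/

/-- A commutative algebra `S` over `C`, generated by the values of a `C`-linear map `ι : M → S`
like a symmetric algebra, on which `M` acts by a flat family of derivations `D y`, to be thought
of as `y • d` for a derivation `d` with `d (ι x) = r x`. -/
structure IsNovikovSymmetric {k C M S : Type*} [CommRing k] [CommRing C] [Algebra k C]
    [AddCommGroup M] [Module k M] [Module C M] [CommRing S] [Algebra k S]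
    [Algebra C S] (r : M →ₗ[k] C) (ι : M →ₗ[C] S) (D : M → Derivation k S S) : Prop where
  ext_zero : ∀ f : Module.End C S, f 1 = 0 → (∀ y s, f (ι y * s) = 0) → f = 0
  span_pow : ⨆ m, (LinearMap.range ι) ^ m = (⊤ : Submodule C S)
  extend : ∀ f : M →ₗ[C] Module.End C S, (∀ y z s, f y (ι z * s) = f z (ι y * s)) →
    ∃ t : Module.End C S, t 1 = 0 ∧ ∀ y s, t (ι y * s) = f y s
  D_add : ∀ y z s, D (y + z) s = D y s + D z s
  D_smul : ∀ (c : C) y s, D (c • y) s = c • D y s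
  D_ι : ∀ y w, D y (ι w) = r w • ι y
  D_coeff : ∀ y c, ∃ c', D y (algebraMap C S c) = algebraMap C S c'
  D_r : ∀ y x, D y (algebraMap C S (r x)) = algebraMap C S (r (r x • y) - r x * r y)
  D_symm : ∀ y z c, ι z * D y (algebraMap C S c) = ι y * D z (algebraMap C S c)
  D_comm : ∀ y z s, D y (D z s) - D z (D y s) = D (r z • y - r y • z) s

/-- The operators `τ n x` on `S` representing multiplication by the derivatives `x⁽ⁿ⁺¹⁾`. -/
structure IsDerivativeTower {k C M S : Type*} [CommRing k] [CommRing C] [Algebra k C]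
    [AddCommGroup M] [Module k M] [Module C M] [CommRing S] [Algebra k S]
    [Algebra C S] (r : M →ₗ[k] C) (ι : M →ₗ[C] S) (D : M → Derivation k S S)
    (τ : ℕ → M → Module.End C S) : Prop where
  zero : ∀ x s, τ 0 x s = r x • s
  succ_one : ∀ n x, τ (n + 1) x 1 = 0
  succ_mul : ∀ n x y s, τ (n + 1) x (ι y * s) = D y (τ n x s) - τ n x (D y s)

section

set_option linter.unusedSectionVars false

variable {k C M S : Type*} [CommRing k] [CommRing C] [Algebra k C]
    [AddCommGroup M] [Module k M] [Module C M] [IsScalarTower k C M] [CommRing S] [Algebra k S]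
    [Algebra C S] [IsScalarTower k C S] {r : M →ₗ[k] C} {ι : M →ₗ[C] S}
    {D : M → Derivation k S S}

namespace IsNovikovSymmetric

variable (h : IsNovikovSymmetric r ι D)
include h

theorem D_smul_coeff (y : M) (c : C) (s : S) :
    D y (c • s) = c • D y s + D y (algebraMap C S c) * s := by
  rw [Algebra.smul_def c s, Derivation.leibniz, smul_eq_mul, smul_eq_mul, Algebra.smul_def]
  ring

/-- Although `D y` is not `C`-linear, its commutator with `t` is: `D y` maps `C` to `C`, so the two
extra terms `D y c • t s` cancel. -/
theorem exists_bracket (y : M) (t : Module.End C S) :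
    ∃ b : Module.End C S, ∀ s, b s = D y (t s) - t (D y s) := by
  refine ⟨{ toFun := fun s => D y (t s) - t (D y s), map_add' := fun a b => ?_,
            map_smul' := fun c s => ?_ }, fun s => rfl⟩
  · simp only [map_add]; abel
  · obtain ⟨c', hc'⟩ := h.D_coeff y c
    simp only [map_smul, h.D_smul_coeff, hc', ← Algebra.smul_def, map_add, RingHom.id_apply,
      smul_sub]
    abel

/-- One step of the recursion. The symmetry hypothesis is what makes `t' (ι y * s) = [D y, t] s`
well defined; flatness `D_comm`, through the Jacobi identity, passes it on to `t'`. -/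
theorem exists_succ (t : Module.End C S)
    (ht : ∀ y z s, D y (t (ι z * s)) - t (D y (ι z * s)) =
      D z (t (ι y * s)) - t (D z (ι y * s))) :
    ∃ t' : Module.End C S, (∀ y z s, D y (t' (ι z * s)) - t' (D y (ι z * s)) =
      D z (t' (ι y * s)) - t' (D z (ι y * s))) ∧
      t' 1 = 0 ∧ ∀ y s, t' (ι y * s) = D y (t s) - t (D y s) := by
  choose b hb using fun y => h.exists_bracket y t
  let f : M →ₗ[C] Module.End C S :=
    { toFun := b
      map_add' := fun y z => by
        ext s
        simp only [hb, LinearMap.add_apply, h.D_add, map_add]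
        abel
      map_smul' := fun c y => by
        ext s
        simp only [hb, LinearMap.smul_apply, h.D_smul, map_smul, RingHom.id_apply, smul_sub] }
  obtain ⟨t', h1, h2⟩ := h.extend f (fun y z s => by
    change b y _ = b z _
    rw [hb, hb, ht])
  have h2' : ∀ y s, t' (ι y * s) = D y (t s) - t (D y s) := fun y s => by
    rw [h2]; exact hb y s
  refine ⟨t', fun y z s => ?_, h1, h2'⟩
  have e : ∀ y z, D y (ι z * s) = ι (r z • y) * s + ι z * D y s := fun y z => by
    rw [Derivation.leibniz, h.D_ι, map_smul, smul_eq_mul, smul_eq_mul]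
    ring
  have c1 := h.D_comm y z (t s)
  have c2 := congrArg t (h.D_comm y z s)
  have c3 := h2' (r z • y - r y • z) s
  rw [← c1, ← c2, map_sub, sub_mul, map_sub] at c3
  rw [e, e, map_add, map_add, h2' z s, h2' y s, h2' z (D y s), h2' y (D z s)]
  simp only [map_sub] at c3 ⊢
  linear_combination -c3

theorem exists_tower : ∃ τ : ℕ → M → Module.End C S, IsDerivativeTower r ι D τ := by
  let G := { t : Module.End C S // ∀ y z s, D y (t (ι z * s)) - t (D y (ι z * s)) =
      D z (t (ι y * s)) - t (D z (ι y * s)) }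
  have hs : ∀ t : G, ∃ t' : G, t'.1 1 = 0 ∧
      ∀ y s, t'.1 (ι y * s) = D y (t.1 s) - t.1 (D y s) := fun t => by
    obtain ⟨t', h1, h2, h3⟩ := h.exists_succ t.1 t.2
    exact ⟨⟨t', h1⟩, h2, h3⟩
  choose next h1 h2 using hs
  -- For multiplication by `r x` the bracket with `D y` is multiplication by `D y (r x)`, and the
  -- symmetry becomes `D_symm`.
  let z : M → G := fun x => ⟨r x • LinearMap.id, fun y z s => by
    simp only [LinearMap.smul_apply, LinearMap.id_apply, h.D_smul_coeff, add_sub_cancel_left]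
    linear_combination s * h.D_symm y z (r x)⟩
  let τ : ℕ → M → G := fun n x => Nat.rec (z x) (fun _ t => next t) n
  exact ⟨fun n x => (τ n x).1, fun x s => rfl, fun n x => h1 (τ n x), fun n x => h2 (τ n x)⟩

theorem D_mem_pow (y : M) {m : ℕ} {s : S} (hs : s ∈ (LinearMap.range ι) ^ m) :
    D y s ∈ (LinearMap.range ι) ^ m := by
  induction m generalizing s with
  | zero =>
    rw [pow_zero, Submodule.mem_one] at hs ⊢
    obtain ⟨c, rfl⟩ := hs
    obtain ⟨c', hc'⟩ := h.D_coeff y c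
    exact ⟨c', hc'.symm⟩
  | succ m ih =>
    rw [pow_succ'] at hs ⊢
    induction hs using Submodule.mul_induction_on' with
    | mem_mul_mem a ha b hb =>
      obtain ⟨w, rfl⟩ := ha
      rw [Derivation.leibniz, h.D_ι, smul_eq_mul, smul_eq_mul, ← map_smul, mul_comm b]
      exact add_mem (Submodule.mul_mem_mul ⟨w, rfl⟩ (ih hb)) (Submodule.mul_mem_mul ⟨_, rfl⟩ hb)
    | add a _ b _ ha hb => rw [map_add]; exact add_mem ha hb

theorem end_ext_pow {f g : Module.End C S}
    (hfg : ∀ m, ∀ s ∈ (LinearMap.range ι) ^ m, f s = g s) : f = g := by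
  have : (⊤ : Submodule C S) ≤ LinearMap.eqLocus f g := by
    rw [← h.span_pow]
    exact iSup_le fun m s hs => hfg m s hs
  ext s
  exact this (Submodule.mem_top (x := s))

theorem end_ext {f g : Module.End C S} (h1 : f 1 = g 1)
    (h2 : ∀ y s, f (ι y * s) = g (ι y * s)) : f = g :=
  sub_eq_zero.1 <| h.ext_zero _ (by rw [LinearMap.sub_apply, h1, sub_self])
    fun y s => by rw [LinearMap.sub_apply, h2, sub_self]

end IsNovikovSymmetric

theorem Submodule.pow_succ_induction {m : ℕ} {p : S → Prop}
    (hmul : ∀ y, ∀ s ∈ (LinearMap.range ι) ^ m, p (ι y * s)) (hadd : ∀ a b, p a → p b → p (a + b))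
    {s : S} (hs : s ∈ (LinearMap.range ι) ^ (m + 1)) : p s := by
  rw [pow_succ'] at hs
  refine Submodule.mul_induction_on hs ?_ hadd
  rintro _ ⟨y, rfl⟩ b hb
  exact hmul y b hb

namespace IsDerivativeTower

variable {τ : ℕ → M → Module.End C S} (ht : IsDerivativeTower r ι D τ)
  (h : IsNovikovSymmetric r ι D)
include ht h

theorem map_add (n : ℕ) (x y : M) : τ n (x + y) = τ n x + τ n y := by
  induction n with
  | zero => ext s; simp only [ht.zero, LinearMap.add_apply, _root_.map_add, add_smul]
  | succ n ih =>
    refine h.end_ext (by simp only [ht.succ_one, LinearMap.add_apply, add_zero]) fun z s => ?_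
    simp only [ht.succ_mul, LinearMap.add_apply, ih, _root_.map_add]
    abel

theorem map_smul (n : ℕ) (c : k) (x : M) : τ n (c • x) = c • τ n x := by
  induction n with
  | zero => ext s; simp only [ht.zero, LinearMap.smul_apply, _root_.map_smul, smul_assoc]
  | succ n ih =>
    refine h.end_ext (by simp only [ht.succ_one, LinearMap.smul_apply, smul_zero]) fun z s => ?_
    simp only [ht.succ_mul, LinearMap.smul_apply, ih, Derivation.map_smul, smul_sub]

theorem mem_pow (n : ℕ) (x : M) {m : ℕ} {s : S} (hs : s ∈ (LinearMap.range ι) ^ (m + n)) :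
    τ n x s ∈ (LinearMap.range ι) ^ m := by
  induction n generalizing s m with
  | zero => rw [ht.zero]; exact Submodule.smul_mem _ _ hs
  | succ n ih =>
    refine Submodule.pow_succ_induction (p := fun s => τ (n + 1) x s ∈ (LinearMap.range ι) ^ m)
      (fun y s hs => ?_) (fun a b ha hb => ?_) hs
    · rw [ht.succ_mul]
      exact sub_mem (h.D_mem_pow y (ih hs)) (ih (h.D_mem_pow y hs))
    · rw [_root_.map_add]; exact add_mem ha hb

theorem apply_eq_zero {n : ℕ} (x : M) {m : ℕ} (hmn : m < n) {s : S}
    (hs : s ∈ (LinearMap.range ι) ^ m) : τ n x s = 0 := by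
  induction n generalizing s m with
  | zero => omega
  | succ n ih =>
    cases m with
    | zero =>
      rw [pow_zero, Submodule.mem_one] at hs
      obtain ⟨c, rfl⟩ := hs
      rw [Algebra.algebraMap_eq_smul_one, _root_.map_smul, ht.succ_one, smul_zero]
    | succ m =>
      refine Submodule.pow_succ_induction (p := fun s => τ (n + 1) x s = 0)
        (fun y s hs => ?_) (fun a b ha hb => by rw [_root_.map_add, ha, hb, add_zero]) hs
      rw [ht.succ_mul, ih (by omega) hs, ih (by omega) (h.D_mem_pow y hs), map_zero, sub_zero]

/-- In these degrees `s` has a factor `ι z` to spare: expanding the bracket with `D z` instead of `D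
y` leaves `ι y` inside, where the two terms containing `D z (ι y)` cancel by induction. Below degree
`n` the identity can fail, since `τ n x` may be nonzero on `ι y * s` when it vanishes on `s`. -/
theorem apply_ι_mul {n : ℕ} (x y : M) {m : ℕ} (hnm : n ≤ m) {s : S}
    (hs : s ∈ (LinearMap.range ι) ^ m) : τ n x (ι y * s) = ι y * τ n x s := by
  induction n generalizing s m y with
  | zero => rw [ht.zero, ht.zero, mul_smul_comm]
  | succ n ih =>
    obtain ⟨m, rfl⟩ : ∃ m', m = m' + 1 := ⟨m - 1, by omega⟩
    refine Submodule.pow_succ_induction (p := fun s => τ (n + 1) x (ι y * s) = ι y * τ (n + 1) x s)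
      (fun z s hs => ?_) (fun a b ha hb => by
        rw [mul_add, _root_.map_add, ha, hb, _root_.map_add, mul_add]) hs
    have e : D z (ι y * s) = ι (r y • z) * s + ι y * D z s := by
      rw [Derivation.leibniz, h.D_ι, _root_.map_smul, smul_eq_mul, smul_eq_mul]
      ring
    have e' : D z (ι y * τ n x s) = ι (r y • z) * τ n x s + ι y * D z (τ n x s) := by
      rw [Derivation.leibniz, h.D_ι, _root_.map_smul, smul_eq_mul, smul_eq_mul]
      ring
    rw [mul_left_comm, ht.succ_mul, ht.succ_mul, ih y (by omega) hs, e, _root_.map_add,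
      ih _ (by omega) hs, ih y (by omega) (h.D_mem_pow z hs), e']
    ring

theorem apply_mul {n : ℕ} (x : M) {i m : ℕ} (hnm : n ≤ m) {t s : S}
    (hi : t ∈ (LinearMap.range ι) ^ i) (hs : s ∈ (LinearMap.range ι) ^ m) :
    τ n x (t * s) = t * τ n x s := by
  induction i generalizing t with
  | zero =>
    rw [pow_zero, Submodule.mem_one] at hi
    obtain ⟨c, rfl⟩ := hi
    rw [← Algebra.smul_def, _root_.map_smul, Algebra.smul_def]
  | succ i ih =>
    refine Submodule.pow_succ_induction (p := fun t => τ n x (t * s) = t * τ n x s)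
      (fun y t hi => ?_) (fun a b ha hb => by rw [add_mul, _root_.map_add, ha, hb, add_mul]) hi
    rw [mul_assoc, ht.apply_ι_mul h (m := i + m) x y (by omega), ih hi, mul_assoc]
    rw [pow_add]
    exact Submodule.mul_mem_mul hi hs

/-- Below degree `n + m` both composites vanish. Above, on `w * t * u` with `t` of degree `m` and
`u` of degree `n`, both equal `w` times the two elements `τ m y t` and `τ n x u` of `C`. -/
theorem commute (n m : ℕ) (x y : M) : τ n x * τ m y = τ m y * τ n x := by
  refine h.end_ext_pow fun j s hs => ?_
  rw [Module.End.mul_apply, Module.End.mul_apply]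
  by_cases hj : j < n + m
  · have vanish : ∀ n m x y, j < n + m → τ n x (τ m y s) = 0 := fun n m x y hj => by
      by_cases hm : j < m
      · rw [ht.apply_eq_zero h y hm hs, map_zero]
      · refine ht.apply_eq_zero h (m := j - m) x (by omega) (ht.mem_pow h m y ?_)
        rwa [Nat.sub_add_cancel (by omega)]
    rw [vanish n m x y hj, vanish m n y x (by omega)]
  · obtain ⟨i, rfl⟩ : ∃ i, j = i + (m + n) := ⟨j - (m + n), by omega⟩
    rw [pow_add, pow_add] at hs
    refine Submodule.mul_induction_on hs (fun w hw v hv => ?_) (fun a b ha hb => by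
      simp only [_root_.map_add, ha, hb])
    refine Submodule.mul_induction_on hv (fun t ht' u hu => ?_) (fun a b ha hb => by
      simp only [mul_add, _root_.map_add, ha, hb])
    have hc := ht.mem_pow h (m := 0) m y (by rwa [zero_add])
    have hc' := ht.mem_pow h (m := 0) n x (by rwa [zero_add])
    rw [pow_zero, Submodule.mem_one] at hc hc'
    obtain ⟨c, hc⟩ := hc
    obtain ⟨c', hc'⟩ := hc'
    have hwt : w * t ∈ (LinearMap.range ι) ^ (i + m) := by
      rw [pow_add]; exact Submodule.mul_mem_mul hw ht'
    have hwu : w * u ∈ (LinearMap.range ι) ^ (i + n) := by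
      rw [pow_add]; exact Submodule.mul_mem_mul hw hu
    have e1 : τ m y (w * (t * u)) = c • (w * u) := by
      rw [mul_comm t u, ← mul_assoc, ht.apply_mul h y le_rfl hwu ht', ← hc, mul_comm,
        Algebra.smul_def]
    have e2 : τ n x (w * (t * u)) = c' • (w * t) := by
      rw [← mul_assoc, ht.apply_mul h x le_rfl hwt hu, ← hc', mul_comm, Algebra.smul_def]
    rw [e1, e2, _root_.map_smul, _root_.map_smul, ht.apply_mul h x le_rfl hw hu,
      ht.apply_mul h y le_rfl hw ht', ← hc, ← hc', Algebra.smul_def, Algebra.smul_def]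
    ring

/-- The commutator of `ι z` and `τ j y` lives only on degree `j - 1` and takes values in degree `0`,
where `τ (i + 1) x` vanishes. -/
theorem succ_apply_ι_mul (i j : ℕ) (x y z : M) (s : S) :
    τ (i + 1) x (ι z * τ j y s) = τ (i + 1) x (τ j y (ι z * s)) := by
  have : τ (i + 1) x * (LinearMap.mulLeft C (ι z) * τ j y) =
      τ (i + 1) x * (τ j y * LinearMap.mulLeft C (ι z)) := by
    refine h.end_ext_pow fun m s hs => ?_
    simp only [Module.End.mul_apply, LinearMap.mulLeft_apply]
    by_cases hj : j ≤ m
    · rw [ht.apply_ι_mul h y z hj hs]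
    · have hzs : ι z * s ∈ (LinearMap.range ι) ^ (m + 1) := by
        rw [pow_succ']; exact Submodule.mul_mem_mul ⟨z, rfl⟩ hs
      rw [ht.apply_eq_zero h y (by omega) hs, mul_zero, map_zero]
      rcases (by omega : m + 1 < j ∨ m + 1 = j) with hm | rfl
      · rw [ht.apply_eq_zero h y hm hzs, map_zero]
      · rw [ht.apply_eq_zero h (m := 0) x (by omega)]
        exact ht.mem_pow h _ y (by rwa [zero_add])
  exact LinearMap.congr_fun this s

/-- The operator form of `[z d, f] = z f'` for `f = x⁽ⁱ⁺¹⁾ y⁽ʲ⁺¹⁾`; the next lemma is the case `f =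
x y⁽ʲ⁺¹⁾`. -/
theorem bracket_mul (i j : ℕ) (x y z : M) (s : S) :
    D z (τ i x (τ j y s)) - τ i x (τ j y (D z s)) =
      τ (i + 1) x (τ j y (ι z * s)) + τ i x (τ (j + 1) y (ι z * s)) := by
  rw [← ht.succ_apply_ι_mul h, ht.succ_mul, ht.succ_mul, map_sub]
  abel

theorem bracket_ι_mul (j : ℕ) (x y z : M) (s : S) :
    D z (τ j y (ι x * s)) - τ j y (ι x * D z s) =
      τ (j + 1) y (ι x * (ι z * s)) + τ j y (τ 0 x (ι z * s)) := by
  rw [mul_left_comm, ht.succ_mul, ht.zero, Derivation.leibniz, h.D_ι, smul_eq_mul, smul_eq_mul,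
    _root_.map_add, mul_smul_comm, mul_comm s]
  abel

end IsDerivativeTower

end

/-! ### The free differential algebra and its normally ordered action -/

open scoped TensorProduct

section

variable {k M : Type*} [CommRing k] [AddCommGroup M] [Module k M]

/-- The free differential commutative algebra on a module `M`: the symmetric algebra of the
countable direct sum of copies of `M`. -/
abbrev FreeDifferential (k M : Type*) [CommRing k] [AddCommGroup M] [Module k M] :=
  SymmetricAlgebra k (ℕ →₀ M)

/-- The `n`-th derivative of the generator `x` of the free differential commutative algebra. -/
noncomputable def FreeDifferential.letter (n : ℕ) : M →ₗ[k] FreeDifferential k M :=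
  SymmetricAlgebra.ι k (ℕ →₀ M) ∘ₗ Finsupp.lsingle n

open FreeDifferential

theorem FreeDifferential.exists_derivation (k M : Type*) [CommRing k] [AddCommGroup M]
    [Module k M] : ∃ d : Derivation k (FreeDifferential k M) (FreeDifferential k M),
      ∀ n x, d (letter n x) = letter (n + 1) x := by
  obtain ⟨d, -, hd⟩ := SymmetricAlgebra.exists_derivation (k := k) (C := k) (M := ℕ →₀ M) 0
    (SymmetricAlgebra.ι k (ℕ →₀ M) ∘ₗ Finsupp.lmapDomain M k Nat.succ)
    (fun c m => by rw [Derivation.zero_apply, zero_smul, zero_add, map_smul])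
  refine ⟨d, fun n x => ?_⟩
  rw [letter, LinearMap.comp_apply, hd, LinearMap.comp_apply, Finsupp.lsingle_apply,
    Finsupp.lmapDomain_apply, Finsupp.mapDomain_single]
  rfl

theorem FreeDifferential.exists_lift_of_commute {B : Type*} [Ring B] [Algebra k B]
    (τ : ℕ → M →ₗ[k] B) (hτ : ∀ i j x y, τ i x * τ j y = τ j y * τ i x) :
    ∃ g : FreeDifferential k M →ₐ[k] B, ∀ n x, g (letter n x) = τ n x := by
  obtain ⟨g, hg⟩ := SymmetricAlgebra.exists_lift_of_commute (Finsupp.lsum k τ) (fun x y => by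
    induction x using Finsupp.induction_linear with
    | zero => simp
    | add a b ha hb => rw [map_add, add_mul, mul_add, ha, hb]
    | single i x =>
      induction y using Finsupp.induction_linear with
      | zero => simp
      | add a b ha hb => rw [map_add, add_mul, mul_add, ha, hb]
      | single j y => simp only [Finsupp.lsum_single, hτ])
  refine ⟨g, fun n x => ?_⟩
  rw [letter, LinearMap.comp_apply, hg, Finsupp.lsingle_apply, Finsupp.lsum_single]

/-- Commuting operators `τ n x` and multiplications by `ι x` on `S` combine to a normally ordered
representation: a linear map vanishing on an element `g` vanishes on the ideal of `g`. -/
theorem FreeDifferential.exists_normalOrder {C S : Type*} [CommRing C] [Algebra k C] [CommRing S]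
    [Algebra k S] [Algebra C S] [IsScalarTower k C S] (ι : M →ₗ[k] S)
    (τ : ℕ → M →ₗ[k] Module.End C S) (hτ : ∀ i j x y, τ i x * τ j y = τ j y * τ i x) :
    ∃ Θ : FreeDifferential k M →ₗ[k] Module.End C S,
      (∀ g, Θ g = 0 → ∀ u, Θ (u * g) = 0) ∧
      (∀ x, Θ (letter 0 x) = LinearMap.mulLeft C (ι x)) ∧
      (∀ n x, Θ (letter (n + 1) x) = τ n x) ∧
      (∀ j x y, Θ (letter 0 x * letter (j + 1) y) = τ j y * LinearMap.mulLeft C (ι x)) ∧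
      (∀ i j x y, Θ (letter (i + 1) x * letter (j + 1) y) = τ i x * τ j y) := by
  obtain ⟨π, hπ⟩ := FreeDifferential.exists_lift_of_commute τ hτ
  let F := FreeDifferential k M
  -- Undifferentiated letters go to `S`; the others go to `F` with index lowered by one, since `τ n
  -- x` stands for `x⁽ⁿ⁺¹⁾`.
  let ℓ : ℕ → M →ₗ[k] F ⊗[k] S := fun n =>
    Nat.casesOn n ((TensorProduct.mk k F S 1) ∘ₗ ι)
      (fun n => ((TensorProduct.mk k F S).flip 1) ∘ₗ letter n)
  obtain ⟨θ, hθ⟩ := FreeDifferential.exists_lift_of_commute ℓ (fun i j x y => mul_comm _ _)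
  have h0 : ∀ x, θ (letter 0 x) = 1 ⊗ₜ ι x := fun x => hθ 0 x
  have h1 : ∀ n x, θ (letter (n + 1) x) = letter n x ⊗ₜ 1 := fun n x => hθ (n + 1) x
  let μ : S →ₗ[k] Module.End C S := ((Algebra.lmul C S).restrictScalars k).toLinearMap
  have hμ : ∀ s, μ s = LinearMap.mulLeft C s := fun s => rfl
  let Ψ : F ⊗[k] S →ₗ[k] Module.End C S :=
    TensorProduct.lift ((LinearMap.mul k (Module.End C S)).compl₁₂ π.toLinearMap μ)
  have hΨ : ∀ p s, Ψ (p ⊗ₜ s) = π p * LinearMap.mulLeft C s := fun p s => rfl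
  -- `Ψ` need not be multiplicative, but new factors enter on the outside, which suffices for
  -- vanishing to pass to ideals.
  have hΨmul : ∀ p s b, Ψ ((p ⊗ₜ s) * b) = π p * Ψ b * LinearMap.mulLeft C s := fun p s b => by
    induction b using TensorProduct.induction_on with
    | zero => simp
    | add a b ha hb => rw [mul_add, map_add, map_add, mul_add, add_mul, ha, hb]
    | tmul q t =>
      rw [Algebra.TensorProduct.tmul_mul_tmul, hΨ, hΨ, map_mul, mul_comm s t,
        LinearMap.mulLeft_mul]
      rfl
  refine ⟨Ψ ∘ₗ θ.toLinearMap, fun g hg u => ?_, fun x => ?_, fun n x => ?_, fun j x y => ?_,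
    fun i j x y => ?_⟩ <;>
  simp only [LinearMap.comp_apply, AlgHom.toLinearMap_apply, map_mul] at *
  · generalize θ u = a
    induction a using TensorProduct.induction_on with
    | zero => simp
    | add a b ha hb => rw [add_mul, map_add, ha, hb, add_zero]
    | tmul p s => rw [hΨmul, hg, mul_zero, zero_mul]
  · rw [h0, hΨ, map_one, one_mul]
  · rw [h1, hΨ, LinearMap.mulLeft_one, hπ]; rfl
  · rw [h0, h1, Algebra.TensorProduct.tmul_mul_tmul, hΨ, one_mul, mul_one, hπ]
  · rw [h1, h1, Algebra.TensorProduct.tmul_mul_tmul, hΨ, one_mul, map_mul,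
      LinearMap.mulLeft_one, hπ, hπ]; rfl

/-- A linear map from `M` to a commutative algebra with a Novikov-symmetric structure factors
through an embedding of `M` into a differential commutative algebra. -/
theorem IsNovikovSymmetric.exists_differential {k : Type*} {C M S : Type*} [CommRing k]
    [CommRing C] [Algebra k C] [AddCommGroup M] [Module k M] [Module C M] [IsScalarTower k C M]
    [CommRing S] [Algebra k S] [Algebra C S] [IsScalarTower k C S] {r : M →ₗ[k] C} {ι : M →ₗ[C] S}
    {D : M → Derivation k S S} (h : IsNovikovSymmetric r ι D) (hι : Function.Injective ι) :
    ∃ (I : Ideal (FreeDifferential k M))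
      (d : Derivation k (FreeDifferential k M ⧸ I) (FreeDifferential k M ⧸ I))
      (j : M →ₗ[k] FreeDifferential k M ⧸ I),
      Function.Injective j ∧ ∀ x y, j (r y • x) = j x * d (j y) := by
  obtain ⟨τ, ht⟩ := h.exists_tower
  let τ' : ℕ → M →ₗ[k] Module.End C S := fun n =>
    { toFun := τ n, map_add' := ht.map_add h n, map_smul' := ht.map_smul h n }
  obtain ⟨Θ, hΘ, h0, h1, h01, h11⟩ := FreeDifferential.exists_normalOrder
    (ι.restrictScalars k) τ' (fun i j x y => ht.commute h i j x y)
  obtain ⟨d, hd⟩ := FreeDifferential.exists_derivation k M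
  let g : M → M → FreeDifferential k M := fun x y =>
    letter 0 (r y • x) - letter 0 x * letter 1 y
  have hdmul : ∀ i j x y, d (letter i x * letter j y) =
      letter (i + 1) x * letter j y + letter i x * letter (j + 1) y := fun i j x y => by
    rw [Derivation.leibniz, hd, hd, smul_eq_mul, smul_eq_mul]
    ring
  have kill : ∀ i x, τ (i + 1) x 1 = 0 := ht.succ_one
  have kill' : ∀ i j x y, τ (i + 1) x (τ j y 1) = 0 := fun i j x y => by
    have := LinearMap.congr_fun (ht.commute h (i + 1) j x y) 1
    rw [Module.End.mul_apply, Module.End.mul_apply, kill, map_zero] at this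
    exact this
  -- Give `x⁽ⁿ⁾` weight `n - 1`. `W` is spanned by the words of the relevant shapes with nonnegative
  -- weight; their derivatives have positive weight, so their images under `Θ` kill `1`. The
  -- condition `1 ≤ i + j` excludes `x y'`, of weight `-1`.
  let W : Submodule k (FreeDifferential k M) := Submodule.span k
    ({f | ∃ n x, f = letter (n + 1) x} ∪
      {f | ∃ i j x y, 1 ≤ i + j ∧ f = letter i x * letter (j + 1) y})
  have hletter : ∀ n x, letter (n + 1) x ∈ W := fun n x =>
    Submodule.subset_span (Or.inl ⟨n, x, rfl⟩)
  have hword : ∀ i j x y, 1 ≤ i + j → letter i x * letter (j + 1) y ∈ W := fun i j x y hij =>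
    Submodule.subset_span (Or.inr ⟨i, j, x, y, hij, rfl⟩)
  have hdW : ∀ f ∈ W, d f ∈ W := fun f hf => by
    induction hf using Submodule.span_induction with
    | zero => rw [map_zero]; exact zero_mem _
    | add a b _ _ ha hb => rw [map_add]; exact add_mem ha hb
    | smul c a _ ha => rw [Derivation.map_smul]; exact W.smul_mem c ha
    | mem f hf =>
      rcases hf with ⟨n, x, rfl⟩ | ⟨i, j, x, y, hij, rfl⟩
      · rw [hd]; exact hletter _ _
      · rw [hdmul]; exact add_mem (hword _ _ _ _ (by omega)) (hword _ _ _ _ (by omega))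
  have hbracket : ∀ f ∈ W, Θ (d f) 1 = 0 ∧
      ∀ z s, D z (Θ f s) - Θ f (D z s) = Θ (d f) (ι z * s) := fun f hf => by
    induction hf using Submodule.span_induction with
    | zero => simp
    | add a b _ _ ha hb =>
      refine ⟨by rw [map_add, map_add, LinearMap.add_apply, ha.1, hb.1, add_zero], fun z s => ?_⟩
      simp only [map_add, LinearMap.add_apply, ← ha.2, ← hb.2]
      abel
    | smul c a _ ha =>
      refine ⟨by rw [Derivation.map_smul, map_smul, LinearMap.smul_apply, ha.1, smul_zero],
        fun z s => ?_⟩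
      simp only [Derivation.map_smul, map_smul, LinearMap.smul_apply, ← ha.2, smul_sub]
    | mem f hf =>
      rcases hf with ⟨n, x, rfl⟩ | ⟨i, j, x, y, hij, rfl⟩
      · rw [hd, h1, h1]
        exact ⟨kill n x, fun z s => (ht.succ_mul n x z s).symm⟩
      · rw [hdmul, map_add, h11]
        cases i with
        | zero =>
          obtain ⟨j, rfl⟩ : ∃ j', j = j' + 1 := ⟨j - 1, by omega⟩
          rw [h01, h01]
          refine ⟨?_, fun z s => ?_⟩
          · change τ 0 x (τ (j + 1) y 1) + τ (j + 2) y (ι x * 1) = 0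
            rw [kill, map_zero, zero_add, ht.apply_eq_zero h (m := 1) y (by omega)]
            rw [pow_one, mul_one]
            exact ⟨x, rfl⟩
          · have hc := LinearMap.congr_fun (ht.commute h 0 (j + 1) x y) (ι z * s)
            have hb := ht.bracket_ι_mul h (j + 1) x y z s
            change _ = τ 0 x (τ (j + 1) y (ι z * s)) + τ (j + 2) y (ι x * (ι z * s))
            rw [Module.End.mul_apply, Module.End.mul_apply] at hc
            rw [hc]
            exact hb.trans (add_comm _ _)
        | succ i =>
          rw [h11, h11]
          refine ⟨?_, fun z s => ht.bracket_mul h i j x y z s⟩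
          change τ (i + 1) x (τ j y 1) + τ i x (τ (j + 1) y 1) = 0
          rw [kill, kill', map_zero, zero_add]
  have hg0 : ∀ x y, Θ (g x y) = 0 := fun x y => by
    ext s
    rw [map_sub, h0, h01]
    change ι (r y • x) * s - τ 0 y (ι x * s) = 0
    rw [ht.zero, map_smul, smul_mul_assoc, sub_self]
  have hdg : ∀ x y, d (g x y) =
      letter 1 (r y • x) - (letter 1 x * letter 1 y + letter 0 x * letter 2 y) := fun x y => by
    rw [map_sub, hd, hdmul]
  have hg1 : ∀ x y, Θ (d (g x y)) = 0 := fun x y => by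
    ext s
    rw [hdg, map_sub, map_add, h1, h11, h01]
    change τ 0 (r y • x) s - (τ 0 x (τ 0 y s) + τ 1 y (ι x * s)) = 0
    rw [ht.succ_mul, ht.zero, ht.zero, ht.zero, ht.zero, h.D_smul_coeff, h.D_r,
      ← Algebra.smul_def, sub_smul, mul_smul, smul_comm (r x)]
    abel
  have hgW : ∀ x y, d (g x y) ∈ W := fun x y => by
    rw [hdg]
    exact sub_mem (hletter _ _) (add_mem (hword 1 0 x y le_rfl) (hword 0 1 x y le_rfl))
  -- The induction starts at the first derivative because `g x y` itself has weight `-1`. From there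
  -- `[D z, Θ f] s = Θ (d f) (ι z * s)` and `Θ (d f) 1 = 0` carry vanishing from `f` to `d f`.
  have hgn : ∀ n x y, d^[n + 1] (g x y) ∈ W ∧ Θ (d^[n + 1] (g x y)) = 0 := fun n x y => by
    induction n with
    | zero => exact ⟨hgW x y, hg1 x y⟩
    | succ n ih =>
      rw [Function.iterate_succ_apply']
      refine ⟨hdW _ ih.1, h.ext_zero _ (hbracket _ ih.1).1 fun z s => ?_⟩
      rw [← (hbracket _ ih.1).2, ih.2]
      simp
  let I : Ideal (FreeDifferential k M) := Ideal.span {f | ∃ n x y, f = d^[n] (g x y)}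
  have hΘI : ∀ f ∈ I, Θ f = 0 := fun f hf => by
    induction hf using Submodule.span_induction with
    | zero => exact map_zero _
    | add a b _ _ ha hb => rw [map_add, ha, hb, add_zero]
    | smul c a _ ha => exact hΘ a ha c
    | mem f hf =>
      obtain ⟨n, x, y, rfl⟩ := hf
      cases n with
      | zero => exact hg0 x y
      | succ n => exact (hgn n x y).2
  have hdI : ∀ f ∈ I, d f ∈ I := fun f hf => by
    induction hf using Submodule.span_induction with
    | zero => rw [map_zero]; exact zero_mem _
    | add a b _ _ ha hb => rw [map_add]; exact add_mem ha hb
    | smul c a haI ha =>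
      rw [smul_eq_mul, Derivation.leibniz]
      exact add_mem (I.smul_mem _ ha) (I.mul_mem_right _ haI)
    | mem f hf =>
      obtain ⟨n, x, y, rfl⟩ := hf
      exact Ideal.subset_span ⟨n + 1, x, y, (Function.iterate_succ_apply' _ _ _).symm⟩
  have hdI' : ∀ f, Ideal.Quotient.mkₐ k I f = 0 → Ideal.Quotient.mkₐ k I (d f) = 0 :=
    fun f hf => Ideal.Quotient.eq_zero_iff_mem.2 (hdI f (Ideal.Quotient.eq_zero_iff_mem.1 hf))
  have hsurj : Function.Surjective (Ideal.Quotient.mkₐ k I) := Ideal.Quotient.mkₐ_surjective k I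
  refine ⟨I, Derivation.liftOfSurjective hsurj hdI',
    (Ideal.Quotient.mkₐ k I).toLinearMap ∘ₗ letter 0, ?_, fun x y => ?_⟩
  · rw [injective_iff_map_eq_zero]
    intro x hx
    have hx' : Θ (letter 0 x) = 0 := hΘI _ (Ideal.Quotient.eq_zero_iff_mem.1 hx)
    rw [h0] at hx'
    have := LinearMap.congr_fun hx' 1
    rw [LinearMap.mulLeft_apply, mul_one] at this
    exact (injective_iff_map_eq_zero ι).1 hι x this
  · simp only [LinearMap.comp_apply, AlgHom.toLinearMap_apply]
    rw [Derivation.liftOfSurjective_apply hsurj hdI', hd, ← map_mul, ← sub_eq_zero, ← map_sub]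
    exact Ideal.Quotient.eq_zero_iff_mem.2 (Ideal.subset_span ⟨0, x, y, rfl⟩)

end

/-! ### The symmetric algebra attached to a Novikov algebra -/

section

variable {k C M : Type*} [CommRing k] [CommRing C] [Algebra k C] [AddCommGroup M] [Module k M]
  [Module C M] [IsScalarTower k C M]

theorem SymmetricAlgebra.iSup_range_ι_pow :
    ⨆ m, (LinearMap.range (SymmetricAlgebra.ι C M)) ^ m = ⊤ := by
  refine eq_top_iff.2 fun s _ => ?_
  induction s using SymmetricAlgebra.induction with
  | algebraMap c =>
    refine Submodule.mem_iSup_of_mem 0 ?_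
    rw [pow_zero, Submodule.mem_one]
    exact ⟨c, rfl⟩
  | ι x =>
    refine Submodule.mem_iSup_of_mem 1 ?_
    rw [pow_one]
    exact ⟨x, rfl⟩
  | add a b ha hb => exact add_mem (ha trivial) (hb trivial)
  | mul a b ha hb =>
    have := Submodule.mul_mem_mul (ha trivial) (hb trivial)
    rw [Submodule.iSup_mul] at this
    simp only [Submodule.mul_iSup, ← pow_add] at this
    refine SetLike.le_def.1 (iSup_le fun i => iSup_le fun j => ?_) this
    exact le_iSup (fun m => (LinearMap.range (SymmetricAlgebra.ι C M)) ^ m) _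

/-- The lift of `m ↦ ε m` to the square-zero extension of `C` by `M` recovers `m`. -/
theorem SymmetricAlgebra.ι_injective : Function.Injective (SymmetricAlgebra.ι C M) := by
  let _ : Module Cᵐᵒᵖ M := Module.compHom _ ((RingHom.id C).fromOpposite mul_comm)
  have : IsCentralScalar C M := ⟨fun _ _ => rfl⟩
  refine Function.LeftInverse.injective (g := fun s =>
    (SymmetricAlgebra.lift (TrivSqZeroExt.inrHom C M) s).snd) fun x => ?_
  simp

/-- A linear endomorphism `t` of the symmetric algebra can be defined by prescribing
`t (ι y * s) = f y s`, if `f y (ι z * s)` is symmetric in `y` and `z`. -/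
theorem SymmetricAlgebra.exists_end (f : M →ₗ[C] Module.End C (SymmetricAlgebra C M))
    (hf : ∀ y z s, f y (SymmetricAlgebra.ι C M z * s) = f z (SymmetricAlgebra.ι C M y * s)) :
    ∃ t : Module.End C (SymmetricAlgebra C M), t 1 = 0 ∧
      ∀ y s, t (SymmetricAlgebra.ι C M y * s) = f y s := by
  let S := SymmetricAlgebra C M
  -- The operators `(v, w) ↦ (ι y * v, f y v)` commute exactly when `f` has the required symmetry.
  -- Extended to `S` and applied to `(1, 0)`, they have `t s` as second coordinate.
  let F : M →ₗ[C] Module.End C (S × S) :=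
    { toFun := fun y => ((LinearMap.mulLeft C (SymmetricAlgebra.ι C M y)).prod (f y)) ∘ₗ
        LinearMap.fst C S S
      map_add' := fun y z => LinearMap.ext fun v => Prod.ext (by
        change SymmetricAlgebra.ι C M (y + z) * v.1 =
          SymmetricAlgebra.ι C M y * v.1 + SymmetricAlgebra.ι C M z * v.1
        rw [map_add, add_mul]) (by
        change f (y + z) v.1 = f y v.1 + f z v.1
        rw [map_add, LinearMap.add_apply])
      map_smul' := fun c y => LinearMap.ext fun v => Prod.ext (by
        change SymmetricAlgebra.ι C M (c • y) * v.1 = c • (SymmetricAlgebra.ι C M y * v.1)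
        rw [map_smul, smul_mul_assoc]) (by
        change f (c • y) v.1 = c • f y v.1
        rw [map_smul, LinearMap.smul_apply]) }
  have hF : ∀ y v, F y v = (SymmetricAlgebra.ι C M y * v.1, f y v.1) := fun y v => rfl
  obtain ⟨g, hg⟩ := SymmetricAlgebra.exists_lift_of_commute F (fun y z => LinearMap.ext fun v => by
    rw [Module.End.mul_apply, Module.End.mul_apply, hF y, hF z, hF z, hF y]
    exact Prod.ext (mul_left_comm _ _ _) (hf _ _ _))
  have hfst : ∀ s v, (g s v).1 = s * v.1 := fun s => by
    induction s using SymmetricAlgebra.induction with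
    | algebraMap c =>
      intro v
      rw [AlgHom.commutes, Module.algebraMap_end_apply, Prod.smul_fst, Algebra.smul_def]
    | ι x => intro v; rw [hg, hF]
    | add a b ha hb => intro v; rw [map_add, LinearMap.add_apply, Prod.fst_add, ha, hb, add_mul]
    | mul a b ha hb => intro v; rw [map_mul, Module.End.mul_apply, ha, hb, mul_assoc]
  refine ⟨LinearMap.snd C S S ∘ₗ LinearMap.applyₗ (1, 0) ∘ₗ g.toLinearMap, ?_, fun y s => ?_⟩
  · change (g 1 (1, 0)).2 = 0
    rw [map_one]
    rfl
  · change (g (_ * s) (1, 0)).2 = _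
    rw [map_mul, Module.End.mul_apply, hg, hF, hfst, mul_one]

theorem SymmetricAlgebra.derivation_ext
    {D E : Derivation k (SymmetricAlgebra C M) (SymmetricAlgebra C M)}
    (h₁ : ∀ c, D (algebraMap C _ c) = E (algebraMap C _ c))
    (h₂ : ∀ m, D (SymmetricAlgebra.ι C M m) = E (SymmetricAlgebra.ι C M m)) : D = E := by
  ext s
  induction s using SymmetricAlgebra.induction with
  | algebraMap c => exact h₁ c
  | ι x => exact h₂ x
  | add a b ha hb => rw [map_add, map_add, ha, hb]
  | mul a b ha hb => rw [Derivation.leibniz, Derivation.leibniz, ha, hb]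

/-- A Novikov product `x ∘ y = r y • x`, given by a faithful action of a commutative algebra `C`
whose commutators with left multiplications are derivations of `C`, makes the symmetric algebra
Novikov-symmetric. -/
theorem SymmetricAlgebra.exists_isNovikovSymmetric [FaithfulSMul C M] (r : M →ₗ[k] C)
    (δ : M → Derivation k C C) (hδ : ∀ y c m, δ y c • m = r (c • m) • y - c • r m • y)
    (hδs : ∀ y z c, δ y c • z = δ z c • y)
    (hr : ∀ x y z, r z • r y • x - r (r z • y) • x = r z • r x • y - r (r z • x) • y) :
    ∃ D, IsNovikovSymmetric r (SymmetricAlgebra.ι C M) (D : M → Derivation k _ _) := by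
  have hD := fun y => SymmetricAlgebra.exists_derivation (δ y)
    (((LinearMap.toSpanSingleton C (SymmetricAlgebra C M)
      (SymmetricAlgebra.ι C M y)).restrictScalars k) ∘ₗ r) (fun c m => by
      change r (c • m) • SymmetricAlgebra.ι C M y = _ + c • r m • SymmetricAlgebra.ι C M y
      simp only [← map_smul, ← map_add]
      rw [hδ, sub_add_cancel])
  choose D hDC hDι' using hD
  have hDι : ∀ y w, D y (SymmetricAlgebra.ι C M w) = r w • SymmetricAlgebra.ι C M y := hDι'
  -- Identities in `C` are checked on `M`, where they become consequences of left-symmetry.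
  have faithful : ∀ {a b : C}, (∀ m : M, a • m = b • m) → a = b := fun h =>
    FaithfulSMul.eq_of_smul_eq_smul h
  have hcomm : ∀ y z m, r (r m • z) • y - r (r m • y) • z = r m • (r z • y - r y • z) :=
    fun y z m => by
      have := hr y z m
      rw [smul_sub]
      rw [sub_eq_sub_iff_add_eq_add] at this ⊢
      rw [add_comm, ← sub_eq_zero]
      rw [← sub_eq_zero] at this
      rw [← neg_eq_zero, ← this]
      abel
  refine ⟨D, ⟨fun f h1 h2 => ?_, SymmetricAlgebra.iSup_range_ι_pow, SymmetricAlgebra.exists_end,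
    fun y z s => ?_, fun c y s => ?_, hDι, fun y c => ⟨_, hDC y c⟩, fun y x => ?_,
    fun y z c => ?_, fun y z s => ?_⟩⟩
  · have : (⊤ : Submodule C (SymmetricAlgebra C M)) ≤ LinearMap.ker f := by
      rw [← SymmetricAlgebra.iSup_range_ι_pow]
      refine iSup_le fun m s hs => ?_
      cases m with
      | zero =>
        rw [pow_zero, Submodule.mem_one] at hs
        obtain ⟨c, rfl⟩ := hs
        rw [LinearMap.mem_ker, Algebra.algebraMap_eq_smul_one, map_smul, h1, smul_zero]
      | succ m =>
        exact Submodule.pow_succ_induction (p := fun s => s ∈ LinearMap.ker f)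
          (fun y s _ => h2 y s) (fun a b => add_mem) hs
    exact LinearMap.ext fun s => this (Submodule.mem_top (x := s))
  · have : D (y + z) = D y + D z := by
      refine SymmetricAlgebra.derivation_ext (fun c => ?_) (fun m => ?_)
      · rw [Derivation.add_apply, hDC, hDC, hDC, ← map_add]
        congr 1
        refine faithful fun m => ?_
        simp only [add_smul, hδ, smul_add]
        abel
      · rw [Derivation.add_apply, hDι, hDι, hDι, map_add, smul_add]
    rw [this, Derivation.add_apply]
  · have : D (c • y) = algebraMap C (SymmetricAlgebra C M) c • D y := by
      refine SymmetricAlgebra.derivation_ext (fun c' => ?_) (fun m => ?_)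
      · rw [Derivation.smul_apply, hDC, hDC, smul_eq_mul, ← map_mul]
        congr 1
        refine faithful fun m => ?_
        simp only [mul_smul, hδ, smul_sub]
        rw [smul_comm (r (c' • m)) c, smul_comm (r m) c, smul_comm c' c]
      · rw [Derivation.smul_apply, hDι, hDι, map_smul, smul_comm, algebraMap_smul]
    rw [this, Derivation.smul_apply, algebraMap_smul]
  · rw [hDC]
    congr 1
    refine faithful fun m => ?_
    rw [hδ, sub_smul, mul_smul]
    have := hr y m x
    rw [← neg_sub, this, neg_sub]
  · simp only [hDC, mul_comm (SymmetricAlgebra.ι C M _), ← Algebra.smul_def, ← map_smul, hδs y z]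
  · have : ⁅D y, D z⁆ = D (r z • y - r y • z) := by
      refine SymmetricAlgebra.derivation_ext (fun c => ?_) (fun m => ?_)
      · rw [Derivation.commutator_apply, hDC, hDC, hDC, hDC, hDC, ← map_sub]
        congr 1
        refine faithful fun m => ?_
        rw [sub_smul, hδ (r z • y - r y • z), ← hcomm, ← hcomm]
        simp only [hδ, map_sub, sub_smul, smul_sub]
        abel
      · rw [Derivation.commutator_apply, hDι, hDι]
        simp only [← map_smul, ← map_sub, hDι, hcomm]
    rw [← this, Derivation.commutator_apply]

open scoped IsMulCommutative in
/-- Every Novikov algebra embeds into a differential commutative algebra. -/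
theorem exists_differential_of_novikov (μ : M →ₗ[k] M →ₗ[k] M)
    (lsymm : ∀ x y z, μ (μ x y) z - μ x (μ y z) = μ (μ y x) z - μ y (μ x z))
    (rcomm : ∀ x y z, μ (μ x y) z = μ (μ x z) y) :
    ∃ (I : Ideal (FreeDifferential k M))
      (d : Derivation k (FreeDifferential k M ⧸ I) (FreeDifferential k M ⧸ I))
      (j : M →ₗ[k] FreeDifferential k M ⧸ I),
      Function.Injective j ∧ ∀ x y, j (μ x y) = j x * d (j y) := by
  have hcomm : ∀ a ∈ Set.range μ.flip, ∀ b ∈ Set.range μ.flip, a * b = b * a := by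
    rintro _ ⟨x, rfl⟩ _ ⟨y, rfl⟩
    ext z
    exact rcomm z y x
  let A : Subalgebra k (Module.End k M) := Algebra.adjoin k (Set.range μ.flip)
  have : IsMulCommutative A := Algebra.isMulCommutative_adjoin k hcomm
  let r : M →ₗ[k] A :=
    { toFun := fun x => ⟨μ.flip x, Algebra.subset_adjoin ⟨x, rfl⟩⟩
      map_add' := fun x y => Subtype.ext (map_add _ x y)
      map_smul' := fun c x => Subtype.ext (map_smul _ c x) }
  have hr : ∀ x y, r y • x = μ x y := fun x y => rfl
  have : FaithfulSMul A M := ⟨fun h => Subtype.ext (LinearMap.ext h)⟩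
  have hmem : ∀ y, ∀ c ∈ A, μ y * c - c * μ y ∈ A := fun y c hc => by
    induction hc using Algebra.adjoin_induction with
    | mem c hc =>
      obtain ⟨x, rfl⟩ := hc
      -- Left-symmetry puts the commutator of a left and a right multiplication back into the
      -- algebra of right multiplications.
      have : μ y * μ.flip x - μ.flip x * μ y = (r (μ y x) - r x * r y).1 := by
        ext m
        change μ y (μ m x) - μ (μ y m) x = μ m (μ y x) - μ (μ m y) x
        rw [← neg_sub, lsymm, neg_sub]
      rw [this]
      exact Subtype.prop _
    | algebraMap c => rw [← Algebra.commutes, sub_self]; exact zero_mem _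
    | add a b _ _ ha hb =>
      have := add_mem ha hb
      convert this using 1
      noncomm_ring
    | mul a b ha' hb' ha hb =>
      have := add_mem (mul_mem ha hb') (mul_mem ha' hb)
      convert this using 1
      noncomm_ring
  let δ : M → Derivation k A A := fun y => Derivation.mk'
    { toFun := fun c => ⟨μ y * c.1 - c.1 * μ y, hmem y c.1 c.2⟩
      map_add' := fun a b => Subtype.ext (by
        change μ y * (a.1 + b.1) - (a.1 + b.1) * μ y =
          (μ y * a.1 - a.1 * μ y) + (μ y * b.1 - b.1 * μ y)
        noncomm_ring)
      map_smul' := fun c a => Subtype.ext (by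
        change μ y * (c • a.1) - (c • a.1) * μ y = c • (μ y * a.1 - a.1 * μ y)
        rw [mul_smul_comm, smul_mul_assoc, smul_sub]) } (fun a b => by
      rw [smul_eq_mul, smul_eq_mul, mul_comm b]
      refine Subtype.ext ?_
      change μ y * (a.1 * b.1) - (a.1 * b.1) * μ y =
        a.1 * (μ y * b.1 - b.1 * μ y) + (μ y * a.1 - a.1 * μ y) * b.1
      noncomm_ring)
  have hδ : ∀ y c m, δ y c • m = μ y (c • m) - c • μ y m := fun y c m => rfl
  have hδs : ∀ y z c, δ y c • z = δ z c • y := fun y z c => by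
    obtain ⟨c, hc⟩ := c
    induction hc using Algebra.adjoin_induction with
    | mem c hc =>
      obtain ⟨x, rfl⟩ := hc
      change μ y (μ z x) - μ (μ y z) x = μ z (μ y x) - μ (μ z y) x
      rw [← neg_sub, lsymm, neg_sub]
    | algebraMap c =>
      change μ y (c • z) - c • μ y z = μ z (c • y) - c • μ z y
      rw [map_smul, map_smul, sub_self, sub_self]
    | add a b ha' hb' ha hb =>
      have : (⟨a + b, add_mem ha' hb'⟩ : A) = ⟨a, ha'⟩ + ⟨b, hb'⟩ := rfl
      rw [this, map_add, map_add, add_smul, add_smul, ha, hb]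
    | mul a b ha' hb' ha hb =>
      have : (⟨a * b, mul_mem ha' hb'⟩ : A) = ⟨a, ha'⟩ * ⟨b, hb'⟩ := rfl
      rw [this, Derivation.leibniz, Derivation.leibniz, add_smul, add_smul, smul_assoc, smul_assoc,
        smul_assoc, smul_assoc, ha, hb]
  obtain ⟨D, hD⟩ := SymmetricAlgebra.exists_isNovikovSymmetric r δ
    (fun y c m => by rw [hδ, hr, hr]) hδs (fun x y z => by simp only [hr]; exact lsymm x y z)
  exact hD.exists_differential SymmetricAlgebra.ι_injective

end

/-! ### Perm-algebras of pairs -/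

/-- Pairs over a ring `A`, with the product `(a, b) * (c, e) = (a * c, a * e)`. -/
@[ext]
structure PermPair (A : Type*) where
  fst : A
  snd : A

namespace PermPair

variable {k A : Type*} [CommRing k] [CommRing A] [Algebra k A]

/-- The underlying pair. -/
def equivProd (A : Type*) : PermPair A ≃ A × A where
  toFun p := (p.fst, p.snd)
  invFun p := ⟨p.1, p.2⟩

instance : AddCommGroup (PermPair A) := (equivProd A).addCommGroup

instance : Module k (PermPair A) := (equivProd A).module k

instance : Mul (PermPair A) := ⟨fun p q => ⟨p.fst * q.fst, p.fst * q.snd⟩⟩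

@[simp] theorem fst_add (p q : PermPair A) : (p + q).fst = p.fst + q.fst := rfl
@[simp] theorem snd_add (p q : PermPair A) : (p + q).snd = p.snd + q.snd := rfl
@[simp] theorem fst_zero : (0 : PermPair A).fst = 0 := rfl
@[simp] theorem snd_zero : (0 : PermPair A).snd = 0 := rfl
@[simp] theorem fst_mul (p q : PermPair A) : (p * q).fst = p.fst * q.fst := rfl
@[simp] theorem snd_mul (p q : PermPair A) : (p * q).snd = p.fst * q.snd := rfl
@[simp] theorem fst_smul (c : k) (p : PermPair A) : (c • p).fst = c • p.fst := rfl
@[simp] theorem snd_smul (c : k) (p : PermPair A) : (c • p).snd = c • p.snd := rfl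

instance : NonUnitalRing (PermPair A) :=
  { (inferInstance : AddCommGroup (PermPair A)), (inferInstance : Mul (PermPair A)) with
    left_distrib := fun a b c => by ext <;> simp [mul_add]
    right_distrib := fun a b c => by ext <;> simp [add_mul]
    zero_mul := fun a => by ext <;> simp
    mul_zero := fun a => by ext <;> simp
    mul_assoc := fun a b c => by ext <;> simp [mul_assoc] }

instance : IsScalarTower k (PermPair A) (PermPair A) :=
  ⟨fun c a b => by ext <;> simp⟩

instance : SMulCommClass k (PermPair A) (PermPair A) :=
  ⟨fun c a b => by ext <;> simp⟩

/-- A derivation acts on pairs componentwise. -/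
def derivation (d : Derivation k A A) : PermPair A →ₗ[k] PermPair A where
  toFun p := ⟨d p.fst, d p.snd⟩
  map_add' p q := by ext <;> simp
  map_smul' c p := by ext <;> simp

@[simp] theorem fst_derivation (d : Derivation k A A) (p : PermPair A) :
    (derivation d p).fst = d p.fst := rfl
@[simp] theorem snd_derivation (d : Derivation k A A) (p : PermPair A) :
    (derivation d p).snd = d p.snd := rfl

theorem isDifferentialPermAlgebra {k : Type*} [Field k] [Algebra k A] (d : Derivation k A A) :
    IsDifferentialPermAlgebra (derivation d) where
  left_comm x y z := by ext <;> simp <;> ring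
  leibniz x y := by ext <;> simp <;> ring

end PermPair

/-! ### The split null extension and the embedding -/

section

variable {k : Type u} {N : Type v} [Field k] [AddCommGroup N] [Module k N]
  {vd dv : N →ₗ[k] N →ₗ[k] N}

/-- The ideal of a dialgebra generated by the differences of the two products. -/
def dialgebraIdeal (vd dv : N →ₗ[k] N →ₗ[k] N) : Submodule k N :=
  Submodule.span k {w | ∃ x y, w = dv x y - vd x y}

/-- A Novikov dialgebra `N` acts on both sides on itself through its quotient by the ideal of
differences, and the split null extension is a Novikov algebra. -/
theorem IsNovikovDialgebra.exists_splitExtension (hN : IsNovikovDialgebra vd dv) :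
    ∃ μ : ((N ⧸ dialgebraIdeal vd dv) × N) →ₗ[k] ((N ⧸ dialgebraIdeal vd dv) × N) →ₗ[k]
        ((N ⧸ dialgebraIdeal vd dv) × N),
      (∀ x y z, μ (μ x y) z - μ x (μ y z) = μ (μ y x) z - μ y (μ x z)) ∧
      (∀ x y z, μ (μ x y) z = μ (μ x z) y) ∧
      ∀ x x' y y', μ ((dialgebraIdeal vd dv).mkQ x, x') ((dialgebraIdeal vd dv).mkQ y, y') =
        ((dialgebraIdeal vd dv).mkQ (vd x y), vd x y' + dv x' y) := by
  let I := dialgebraIdeal vd dv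
  have hI : ∀ x y, dv x y - vd x y ∈ I := fun x y => Submodule.subset_span ⟨x, y, rfl⟩
  have hI' : ∀ x y, I.mkQ (dv x y) = I.mkQ (vd x y) := fun x y =>
    (Submodule.Quotient.eq I).2 (hI x y)
  have h1 : I ≤ LinearMap.ker vd := Submodule.span_le.2 (by
    rintro _ ⟨x, y, rfl⟩
    refine LinearMap.ext fun z => ?_
    rw [map_sub, LinearMap.sub_apply, hN.zero_left, sub_self, LinearMap.zero_apply])
  have h2 : I ≤ LinearMap.ker dv.flip := Submodule.span_le.2 (by
    rintro _ ⟨x, y, rfl⟩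
    refine LinearMap.ext fun z => ?_
    rw [map_sub, LinearMap.sub_apply, LinearMap.flip_apply, LinearMap.flip_apply, hN.zero_right,
      sub_self, LinearMap.zero_apply])
  let L : (N ⧸ I) →ₗ[k] N →ₗ[k] N := I.liftQ vd h1
  let R : (N ⧸ I) →ₗ[k] N →ₗ[k] N := I.liftQ dv.flip h2
  -- Modulo `I` the product `⊢` may be replaced by `⊣`, which vanishes when its right factor is in
  -- `I`.
  have h3 : I ≤ LinearMap.ker (L.compr₂ I.mkQ).flip := Submodule.span_le.2 (by
    rintro _ ⟨y, z, rfl⟩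
    refine LinearMap.ext fun x => ?_
    obtain ⟨x, rfl⟩ := I.mkQ_surjective x
    change I.mkQ (vd x (dv y z - vd y z)) = 0
    rw [← hI', ← LinearMap.flip_apply, h2 (hI y z), LinearMap.zero_apply, map_zero])
  let Q : (N ⧸ I) →ₗ[k] (N ⧸ I) →ₗ[k] N ⧸ I := (I.liftQ (L.compr₂ I.mkQ).flip h3).flip
  let μ : ((N ⧸ I) × N) →ₗ[k] ((N ⧸ I) × N) →ₗ[k] ((N ⧸ I) × N) :=
    LinearMap.mk₂ k (fun p q => (Q p.1 q.1, L p.1 q.2 + R q.1 p.2))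
      (fun p p' q => Prod.ext (by simp) (by simp; abel))
      (fun c p q => Prod.ext (by simp) (by simp))
      (fun p q q' => Prod.ext (by simp) (by simp; abel))
      (fun c p q => Prod.ext (by simp) (by simp))
  have hμ : ∀ x x' y y', μ (I.mkQ x, x') (I.mkQ y, y') =
      (I.mkQ (vd x y), vd x y' + dv x' y) := fun x x' y y' => rfl
  refine ⟨μ, ?_, ?_, hμ⟩
  · rintro ⟨x, x'⟩ ⟨y, y'⟩ ⟨z, z'⟩
    obtain ⟨x, rfl⟩ := I.mkQ_surjective x
    obtain ⟨y, rfl⟩ := I.mkQ_surjective y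
    obtain ⟨z, rfl⟩ := I.mkQ_surjective z
    simp only [hμ]
    refine Prod.ext ?_ ?_
    · simp only [Prod.fst_sub, ← map_sub, hN.leftSymm_vd x y z]
    · simp only [Prod.snd_sub, map_add, LinearMap.add_apply]
      have e1 := hN.leftSymm_vd x y z'
      have e2 := hN.leftSymm_dv x' y z
      have e3 := hN.leftSymm_dv y' x z
      have e4 := hN.zero_right x' y z
      have e5 := hN.zero_right y' x z
      -- The product of `N̄` is represented by `⊢`, whereas `leftSymm_dv` has `⊣` inside;
      -- `zero_right` reconciles them.
      rw [e4, e5]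
      rw [sub_eq_iff_eq_add] at e1 e2 e3
      rw [e1, e2, e3]
      abel
  · rintro ⟨x, x'⟩ ⟨y, y'⟩ ⟨z, z'⟩
    obtain ⟨x, rfl⟩ := I.mkQ_surjective x
    obtain ⟨y, rfl⟩ := I.mkQ_surjective y
    obtain ⟨z, rfl⟩ := I.mkQ_surjective z
    simp only [hμ]
    refine Prod.ext ?_ ?_
    · change I.mkQ _ = I.mkQ _
      rw [← hI', hN.rightComm_vd]
    · simp only [map_add, LinearMap.add_apply]
      rw [hN.rightComm_vd x y' z, hN.rightComm_dv x' y z, hN.rightComm_vd x z' y]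
      abel

end

theorem mainTheorem3 {k : Type u} {N : Type v} [Field k] [AddCommGroup N] [Module k N]
    (vd dv : N →ₗ[k] N →ₗ[k] N) (hN : IsNovikovDialgebra vd dv) :
    ∃ (P : Type (max u v)) (_ : NonUnitalRing P) (_ : Module k P)
      (_ : IsScalarTower k P P) (_ : SMulCommClass k P P)
      (d : P →ₗ[k] P) (ι : N →ₗ[k] P),
      IsDifferentialPermAlgebra d ∧
      Function.Injective ι ∧
      (∀ x y : N, ι (vd x y) = ι x * d (ι y)) ∧
      (∀ x y : N, ι (dv x y) = d (ι y) * ι x) := by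
  obtain ⟨μ, hl, hr, hμ⟩ := hN.exists_splitExtension
  obtain ⟨I, d, j, hj, hjμ⟩ := exists_differential_of_novikov μ hl hr
  let q := (dialgebraIdeal vd dv).mkQ
  have hq : ∀ x y, q (dv x y) = q (vd x y) := fun x y =>
    (Submodule.Quotient.eq _).2 (Submodule.subset_span ⟨x, y, rfl⟩)
  have h₀ : ∀ x y, μ (q x, 0) (q y, 0) = (q (vd x y), 0) := fun x y => by
    rw [hμ, map_zero, map_zero, LinearMap.zero_apply, add_zero]
  have h₁ : ∀ x y, μ (q x, 0) (0, y) = (0, vd x y) := fun x y => by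
    have := hμ x 0 0 y
    rwa [map_zero, map_zero, map_zero, map_zero, add_zero] at this
  have h₂ : ∀ x y, μ (0, x) (q y, 0) = (0, dv x y) := fun x y => by
    have := hμ 0 x y 0
    rwa [map_zero, map_zero, map_zero, LinearMap.zero_apply, map_zero, zero_add] at this
  -- The second coordinate alone gives injectivity; the first makes `N` act through `N̄`.
  let ι : N →ₗ[k] PermPair (FreeDifferential k ((N ⧸ dialgebraIdeal vd dv) × N) ⧸ I) :=
    { toFun := fun x => ⟨j (q x, 0), j (0, x)⟩
      map_add' := fun x y => PermPair.ext
        (by rw [PermPair.fst_add, ← map_add, Prod.mk_add_mk, map_add, add_zero])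
        (by rw [PermPair.snd_add, ← map_add, Prod.mk_add_mk, add_zero])
      map_smul' := fun c x => PermPair.ext
        (by rw [RingHom.id_apply, PermPair.fst_smul, ← map_smul, Prod.smul_mk, map_smul, smul_zero])
        (by rw [RingHom.id_apply, PermPair.snd_smul, ← map_smul, Prod.smul_mk, smul_zero]) }
  refine ⟨PermPair (FreeDifferential k ((N ⧸ dialgebraIdeal vd dv) × N) ⧸ I), inferInstance,
    inferInstance, inferInstance, inferInstance, PermPair.derivation d, ι,
    PermPair.isDifferentialPermAlgebra d, fun x y hxy => ?_, fun x y => PermPair.ext ?_ ?_,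
    fun x y => PermPair.ext ?_ ?_⟩
  · exact congrArg Prod.snd (hj (congrArg PermPair.snd hxy))
  · change j (q (vd x y), 0) = j (q x, 0) * d (j (q y, 0))
    rw [← hjμ, h₀]
  · change j (0, vd x y) = j (q x, 0) * d (j (0, y))
    rw [← hjμ, h₁]
  · change j (q (dv x y), 0) = d (j (q y, 0)) * j (q x, 0)
    rw [mul_comm, ← hjμ, h₀, hq]
  · change j (0, dv x y) = d (j (q y, 0)) * j (0, x)
    rw [mul_comm, ← hjμ, h₂]
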